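/- Conventions. A Polish abelian group is a Hausdorff topological abelian group whose topology is separable and completely metrizable. An abelian Polish group is a Lie group if it is isomorphic, as a topological group, to $\mathbb{R}^n\oplus\mathbb{T}^d\oplus D$ for some $n,d\in\mathbb{N}$ and some countable discrete abelian group $D$. For a Polish abelian group $G$, let $\mathcal{N}(G)$ be the collection of closed subgroups $N$ of $G$ such that $G/N$ is a Lie group; $G$ is pro-Lie if every neighborhood of $0$ in $G$ contains an element of $\mathcal{N}(G)$. A pro-Lie Polish abelian group $G$ has type $\mathbb{Z}$ if for every $M\in\mathcal{N}(G)$ there is $N\in\mathcal{N}(G)$ with $N\subseteq M$ such that $G/N$ is discrete and torsion-free. Let $\mathbf{proLiePAb}$ be the category of pro-Lie Polish abelian groups and continuous homomorphisms, endowed with the exact structure in which the short exact sequences are all the kernel-cokernel pairs, and let $\mathbf{proLiePAb}_{\mathbb{Z}}$ be its full subcategory of groups of type $\mathbb{Z}$, whose short exact sequences are the short exact sequences of $\mathbf{proLiePAb}$ with all terms of type $\mathbb{Z}$. An object $I$ of $\mathbf{proLiePAb}_{\mathbb{Z}}$ is injective if for every short exact sequence $X_1\to X_2\to X_3$ in $\mathbf{proLiePAb}_{\mathbb{Z}}$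 the induced sequence of abelian groups $0\to\mathrm{Hom}(X_3,I)\to\mathrm{Hom}(X_2,I)\to\mathrm{Hom}(X_1,I)\to 0$ is exact. Theorem. Let $A$ be a type $\mathbb{Z}$ pro-Lie Polish abelian group. The following assertions are equivalent: 1. $A$ is injective in $\mathbf{proLiePAb}_{\mathbb{Z}}$; 2. $A$ is divisible, that is, for every $x\in A$ and every integer $n\geq 1$ there is $y\in A$ with $ny=x$; 3. $A$ is isomorphic, as a topological group, to $\mathbb{Q}^{\alpha}\oplus(\mathbb{Q}^{(\omega)})^{\beta}$ for some $\alpha,\beta\leq\omega$, where $\mathbb{Q}$ and the direct sum $\mathbb{Q}^{(\omega)}$ of countably infinitely many copies of $\mathbb{Q}$ are discrete, and the powers of exponents $\alpha$ and $\beta$ have the product topology. -/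

import Mathlib

open CategoryTheory CategoryTheory.Limits

universe u

/-- A copy of the group `M`, to be equipped with the discrete topology. -/
def DiscreteCopy (M : Type u) : Type u := M

instance (M : Type u) [AddCommGroup M] : AddCommGroup (DiscreteCopy M) :=
  inferInstanceAs (AddCommGroup M)

instance (M : Type u) : TopologicalSpace (DiscreteCopy M) := ⊥

instance (M : Type u) : DiscreteTopology (DiscreteCopy M) := ⟨rfl⟩

/-- The von Neumann ordinal `α = {n ∈ ℕ | n < α}`, for `α ≤ ω`. -/
def OrdIndex (α : ℕ∞) : Type := {n : ℕ // (n : ℕ∞) < α}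

/-- Abelian Lie groups that are Polish: `ℝⁿ ⊕ 𝕋ᵈ ⊕ D` with `D` countable and discrete. -/
def IsLieAb (G : Type u) [AddCommGroup G] [TopologicalSpace G] : Prop :=
  ∃ (n d : ℕ) (D : Type u) (_ : AddCommGroup D) (_ : TopologicalSpace D)
    (_ : DiscreteTopology D) (_ : Countable D),
    Nonempty (G ≃ₜ+ (Fin n → ℝ) × (Fin d → UnitAddCircle) × D)

/-- The collection `𝒩(G)` of co-Lie closed subgroups of `G`. -/
def coLie (G : Type u) [AddCommGroup G] [TopologicalSpace G] : Set (AddSubgroup G) :=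
  {N | IsClosed (N : Set G) ∧ IsLieAb (G ⧸ N)}

/-- Every zero neighborhood contains a co-Lie closed subgroup. -/
def IsProLieAb (G : Type u) [AddCommGroup G] [TopologicalSpace G] : Prop :=
  ∀ U ∈ nhds (0 : G), ∃ N ∈ coLie G, (N : Set G) ⊆ U

/-- Type `ℤ`: the `N ∈ 𝒩(G)` such that `G ⧸ N` is discrete and torsion-free are cofinal in
`𝒩(G)`, ordered by reverse inclusion. -/
def IsTypeZ (G : Type u) [AddCommGroup G] [TopologicalSpace G] : Prop :=
  ∀ M ∈ coLie G, ∃ N ∈ coLie G, N ≤ M ∧ DiscreteTopology (G ⧸ N) ∧ IsAddTorsionFree (G ⧸ N)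

/-- Divisible abelian groups. -/
def IsDivisibleGroup (G : Type u) [AddCommGroup G] : Prop :=
  ∀ n : ℕ, 0 < n → ∀ x : G, ∃ y : G, n • y = x

/-- Polish abelian groups. -/
structure PAb : Type (u + 1) where
  carrier : Type u
  [addCommGroup : AddCommGroup carrier]
  [topologicalSpace : TopologicalSpace carrier]
  [isTopologicalAddGroup : IsTopologicalAddGroup carrier]
  [polishSpace : PolishSpace carrier]

namespace PAb

instance : CoeSort PAb.{u} (Type u) := ⟨PAb.carrier⟩

attribute [instance] addCommGroup topologicalSpace isTopologicalAddGroup polishSpace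

/-- The category of Polish abelian groups and continuous group homomorphisms. -/
instance : Category PAb.{u} where
  Hom A B := A →ₜ+ B
  id A := ContinuousAddMonoidHom.id A
  comp f g := ContinuousAddMonoidHom.comp g f

/-- Morphisms are added pointwise. -/
instance : Preadditive PAb.{u} where
  homGroup A B := inferInstanceAs (AddCommGroup (A →ₜ+ B))
  add_comp A B C f g h := by
    refine ContinuousAddMonoidHom.ext fun x => ?_
    exact map_add (show B →ₜ+ C from h) ((show A →ₜ+ B from f) x) ((show A →ₜ+ B from g) x)
  comp_add _ _ _ _ _ _ := rfl

end PAb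

/-- The category of pro-Lie Polish abelian groups, a full subcategory of `PAb`. -/
abbrev ProLiePAb : Type (u + 1) :=
  ObjectProperty.FullSubcategory fun A : PAb.{u} => IsProLieAb A

/-- The property of being of type `ℤ`, on pro-Lie Polish abelian groups. -/
def typeZ : ObjectProperty ProLiePAb.{u} := fun A => IsTypeZ A.obj

/-- The category of pro-Lie Polish abelian groups of type `ℤ`, a full subcategory of
`ProLiePAb`. -/
abbrev ProLiePAbZ : Type (u + 1) := (typeZ.{u}).FullSubcategory

/-- The underlying Polish abelian group of a type `ℤ` pro-Lie Polish abelian group. -/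
abbrev ProLiePAbZ.toPAb (A : ProLiePAbZ.{u}) : PAb.{u} := A.obj.obj

/-- `S` is a kernel-cokernel pair: its first arrow is a kernel of its second arrow, and its second
arrow is a cokernel of its first arrow. -/
def IsKernelCokernelPair {C : Type*} [Category C] [HasZeroMorphisms C] (S : ShortComplex C) :
    Prop :=
  Nonempty (IsLimit (KernelFork.ofι S.f S.zero)) ∧
    Nonempty (IsColimit (CokernelCofork.ofπ S.g S.zero))

/-- The exact structure of the fully exact subcategory of type `ℤ` groups: the short exact
sequences are those of `ProLiePAb`, that is, the kernel-cokernel pairs of `ProLiePAb`, whose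
objects are of type `ℤ`. -/
def ProLiePAbZ.IsShortExact (S : ShortComplex ProLiePAbZ.{u}) : Prop :=
  IsKernelCokernelPair (S.map (typeZ.{u}).ι)

/-- Injective objects of the exact category `ProLiePAbZ`: the functor `Hom(-, I)` sends every
short exact sequence `X₁ ⟶ X₂ ⟶ X₃` to a short exact sequence
`0 ⟶ Hom(X₃, I) ⟶ Hom(X₂, I) ⟶ Hom(X₁, I) ⟶ 0` of abelian groups. -/
def ProLiePAbZ.IsInjective (I : ProLiePAbZ.{u}) : Prop :=
  ∀ S : ShortComplex ProLiePAbZ.{u}, ProLiePAbZ.IsShortExact S →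
    Function.Injective (fun h : S.X₃ ⟶ I => S.g ≫ h) ∧
      Function.Exact (fun h : S.X₃ ⟶ I => S.g ≫ h) (fun h : S.X₂ ⟶ I => S.f ≫ h) ∧
        Function.Surjective (fun h : S.X₂ ⟶ I => S.f ≫ h)

/-! ### Open pure subgroups and completeness -/

section OpenSubgroups

variable {A : Type u} [AddCommGroup A] [TopologicalSpace A] [IsTopologicalAddGroup A]

/-! Type `ℤ` means that zero has a decreasing basis of open pure subgroups `N k`; the quotients `A ⧸
N k` are countable, discrete and torsion-free, and `A` is their limit by completeness.

Injective implies divisible: extending homomorphisms along `1 - nX` on `ℤ[X]`, whose cokernel is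
`ℤ[1/n]`, solves `b k - n • b (k + 1) = a k` in `A` for every sequence `a`, hence in each `A ⧸ N k`.
There are uncountably many sequences with values in `{0, c}`, so in a countable quotient two of them
have solutions with the same initial term, and their first disagreement exhibits `c` as a multiple
of `n`. Divisibility of all the quotients passes to `A` by purity and completeness
(`isDivisibleGroup_of_dense`).

Divisible implies the normal form: `A` is a rational vector space filtered by the subspaces `N k`;
linear complements split the filtration, so `A` is a product of countable discrete rational spaces
(`IsOpenPureBasis.exists_equiv_pi`).

The normal form implies injective: a homomorphism to a discrete group kills an open subgroup, so
extending it is a problem about abstract groups, solved by injectivity of divisible groups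
(`exists_extension_of_discrete`). The kernel must carry the subspace topology, which is
`IsShortExact.comap_le`. -/

theorem countable_quotient_of_isOpen [TopologicalSpace.SeparableSpace A] {N : AddSubgroup A}
    (hN : IsOpen (N : Set A)) : Countable (A ⧸ N) := by
  have := QuotientAddGroup.discreteTopology hN
  have : TopologicalSpace.SeparableSpace (A ⧸ N) :=
    (QuotientAddGroup.mk_surjective (s := N)).denseRange.separableSpace
      QuotientAddGroup.continuous_mk
  exact TopologicalSpace.separableSpace_iff_countable.mp this

theorem isLieAb_of_discrete (D : Type u) [AddCommGroup D] [TopologicalSpace D]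
    [DiscreteTopology D] [Countable D] : IsLieAb D :=
  ⟨0, 0, D, inferInstance, inferInstance, inferInstance, inferInstance,
    ⟨{ toFun := fun x => (0, 0, x)
       invFun := fun x => x.2.2
       left_inv := fun _ => rfl
       right_inv := fun x => Prod.ext (Subsingleton.elim _ _)
        (Prod.ext (Subsingleton.elim _ _) rfl)
       map_add' := fun x y => by simp
       continuous_toFun := by fun_prop
       continuous_invFun := by fun_prop }⟩⟩

theorem mem_coLie_of_isOpen [TopologicalSpace.SeparableSpace A] {N : AddSubgroup A}
    (hN : IsOpen (N : Set A)) : N ∈ coLie A := by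
  have := QuotientAddGroup.discreteTopology hN
  have := countable_quotient_of_isOpen hN
  exact ⟨N.isClosed_of_isOpen hN, isLieAb_of_discrete _⟩

theorem isProLieAb_of_discrete (D : Type u) [AddCommGroup D] [TopologicalSpace D]
    [DiscreteTopology D] [Countable D] : IsProLieAb D := fun U hU =>
  ⟨⊥, mem_coLie_of_isOpen (isOpen_discrete _), by simpa using mem_of_mem_nhds hU⟩

theorem isTypeZ_of_discrete (D : Type u) [AddCommGroup D] [TopologicalSpace D]
    [DiscreteTopology D] [Countable D] [IsAddTorsionFree D] : IsTypeZ D := fun _ _ =>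
  ⟨⊥, mem_coLie_of_isOpen (isOpen_discrete _), bot_le,
    QuotientAddGroup.discreteTopology (isOpen_discrete _),
    (QuotientAddGroup.quotientBot (G := D)).injective.isAddTorsionFree
      (QuotientAddGroup.quotientBot (G := D)).toAddMonoidHom⟩

/-- Discreteness of the quotient is openness of the subgroup, and torsion-freeness is purity. -/
theorem exists_isOpen_pure_subset (hA : IsProLieAb A) (hZ : IsTypeZ A) {U : Set A}
    (hU : U ∈ nhds 0) : ∃ N : AddSubgroup A, IsOpen (N : Set A) ∧ (N : Set A) ⊆ U ∧
      ∀ n : ℕ, 0 < n → ∀ x : A, n • x ∈ N → x ∈ N := by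
  obtain ⟨M, hM, hMU⟩ := hA U hU
  obtain ⟨N, -, hNM, hd, ht⟩ := hZ M hM
  refine ⟨N, QuotientAddGroup.discreteTopology_iff.mp hd, fun x hx => hMU (hNM hx),
    fun n hn x hx => ?_⟩
  rw [← QuotientAddGroup.eq_zero_iff] at hx ⊢
  rw [QuotientAddGroup.mk_nsmul] at hx
  exact (smul_eq_zero_iff_right hn.ne').mp hx

/-- A neighborhood basis of zero consisting of a decreasing sequence of open pure subgroups. -/
structure IsOpenPureBasis (N : ℕ → AddSubgroup A) : Prop where
  antitone : Antitone N
  isOpen : ∀ k, IsOpen (N k : Set A)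
  pure : ∀ k, ∀ n : ℕ, 0 < n → ∀ x : A, n • x ∈ N k → x ∈ N k
  exists_subset : ∀ U ∈ nhds (0 : A), ∃ k, (N k : Set A) ⊆ U

theorem exists_isOpenPureBasis [FirstCountableTopology A] (hA : IsProLieAb A) (hZ : IsTypeZ A) :
    ∃ N : ℕ → AddSubgroup A, IsOpenPureBasis N := by
  obtain ⟨U, hU⟩ := (nhds (0 : A)).exists_antitone_basis
  choose N hNo hNU hNp using fun k => exists_isOpen_pure_subset hA hZ (hU.1.mem_of_mem (i := k) trivial)
  refine ⟨fun k => ⨅ i ∈ Finset.range (k + 1), N i, fun k l hkl => ?_, fun k => ?_,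
    fun k n hn x hx => ?_, fun V hV => ?_⟩
  · exact biInf_mono fun i hi => by simp only [Finset.mem_range] at hi ⊢; omega
  · simp only [AddSubgroup.coe_iInf]
    exact isOpen_biInter_finset fun i _ => hNo i
  · simp only [AddSubgroup.mem_iInf] at hx ⊢
    exact fun i hi => hNp i n hn x (hx i hi)
  · obtain ⟨k, -, hk⟩ := hU.1.mem_iff.mp hV
    refine ⟨k, fun x hx => hk (hNU k ?_)⟩
    simp only [SetLike.mem_coe, AddSubgroup.mem_iInf] at hx
    exact hx k (by simp)

omit [IsTopologicalAddGroup A] in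
theorem IsOpenPureBasis.eq_zero [T1Space A] {N : ℕ → AddSubgroup A} (hN : IsOpenPureBasis N)
    {x : A} (hx : ∀ k, x ∈ N k) : x = 0 := by
  by_contra h
  obtain ⟨k, hk⟩ := hN.exists_subset {x}ᶜ (isOpen_compl_singleton.mem_nhds (Ne.symm h))
  exact hk (hx k) rfl

omit [TopologicalSpace A] [IsTopologicalAddGroup A] in
theorem sub_mem_of_le {N : ℕ → AddSubgroup A} (hN : Antitone N) {x : ℕ → A}
    (hx : ∀ k, x (k + 1) - x k ∈ N k) {k l : ℕ} (hkl : k ≤ l) : x l - x k ∈ N k := by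
  induction l, hkl using Nat.le_induction with
  | base => simp
  | succ l hl ih => simpa using add_mem (hN hl (hx l)) ih

open TopologicalSpace in
/-- A completely metrizable topological abelian group whose topology is given by a decreasing
sequence of open subgroups is complete: coherent sequences of cosets have a common point. -/
theorem exists_forall_sub_mem [IsCompletelyMetrizableSpace A] {N : ℕ → AddSubgroup A}
    (hN : Antitone N) (hNo : ∀ k, IsOpen (N k : Set A))
    (hNb : ∀ U ∈ nhds (0 : A), ∃ k, (N k : Set A) ⊆ U) {x : ℕ → A}
    (hx : ∀ k, x (k + 1) - x k ∈ N k) : ∃ a, ∀ k, a - x k ∈ N k := by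
  let _ := upgradeIsCompletelyMetrizable A
  have hx' : ∀ {k l : ℕ}, k ≤ l → x l - x k ∈ N k := fun h => sub_mem_of_le hN hx h
  have small : ∀ (a : A) (ε : ℝ), 0 < ε → ∀ m, ∃ l > m, ∀ y, y - a ∈ N l → dist y a < ε := by
    intro a ε hε m
    have : (fun z => z + a) ⁻¹' Metric.ball a ε ∈ nhds (0 : A) :=
      (continuous_add_const a).continuousAt.preimage_mem_nhds
        (by simpa using Metric.ball_mem_nhds a hε)
    obtain ⟨k, hk⟩ := hNb _ this
    refine ⟨max k (m + 1), by simp, fun y hy => ?_⟩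
    simpa using hk (hN (le_max_left _ _) hy)
  -- The metric need not be invariant, so `x` itself may fail to be Cauchy. As in the Baire category
  -- argument that the dense subgroup `A` of its completion meets its translate by the limit of `x`,
  -- that limit is sought as a difference `a - b`. Each step moves `a` and `b` within their cosets
  -- so that the new cosets lie in small balls, keeping `a - b` congruent to `x m` modulo `N m`.
  have step : ∀ (j : ℕ) (s : {s : ℕ × A × A // s.2.1 - s.2.2 - x s.1 ∈ N s.1}),
      ∃ t : {s : ℕ × A × A // s.2.1 - s.2.2 - x s.1 ∈ N s.1},
        s.1.1 < t.1.1 ∧ t.1.2.1 - s.1.2.1 ∈ N s.1.1 ∧ t.1.2.2 - s.1.2.2 ∈ N s.1.1 ∧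
        (∀ y, y - t.1.2.1 ∈ N t.1.1 → dist y t.1.2.1 < 1 / (j + 1 : ℝ)) ∧
        (∀ y, y - t.1.2.2 ∈ N t.1.1 → dist y t.1.2.2 < 1 / (j + 1 : ℝ)) := by
    rintro j ⟨⟨m, a, b⟩, hs⟩
    have hε : (0 : ℝ) < 1 / (j + 1 : ℝ) := by positivity
    -- The new `a` depends on `m''`, so its coset is controlled through the old `a`: both lie in the
    -- ball of radius `ε / 2`.
    obtain ⟨m', hm', ha⟩ := small a _ (half_pos hε) m
    obtain ⟨m'', hm'', hb⟩ := small (a - x m') _ hε m'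
    have haa : a - x m' + x m'' - a ∈ N m' := by
      convert hx' hm''.le using 1; abel
    refine ⟨⟨(m'', a - x m' + x m'', a - x m'), by simp⟩, hm'.trans hm'', hN hm'.le haa,
      ?_, fun y hy => ?_, hb⟩
    · convert sub_mem hs (hx' hm'.le) using 1
      simp only; abel
    · have h1 := ha y (by simpa using add_mem (hN hm''.le hy) haa)
      have h2 := ha _ haa
      have := dist_triangle_right y (a - x m' + x m'') a
      dsimp only at *
      linarith
  choose f hf using step
  let s : ℕ → {s : ℕ × A × A // s.2.1 - s.2.2 - x s.1 ∈ N s.1} := fun j =>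
    Nat.rec ⟨(0, x 0, 0), by simp⟩ f j
  have hs : ∀ j, s (j + 1) = f j (s j) := fun j => rfl
  have hmono : StrictMono fun j => (s j).1.1 := strictMono_nat_of_lt_succ fun j => (hf j (s j)).1
  have lim : ∀ p : A × A → A,
      (∀ j, p (s (j + 1)).1.2 - p (s j).1.2 ∈ N (s j).1.1) →
      (∀ j, ∀ y, y - p (s (j + 1)).1.2 ∈ N (s (j + 1)).1.1 →
        dist y (p (s (j + 1)).1.2) < 1 / (j + 1 : ℝ)) →
      ∃ c, ∀ j, c - p (s j).1.2 ∈ N (s j).1.1 := by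
    intro p h1 h2
    have h3 : ∀ {j l : ℕ}, j ≤ l → p (s l).1.2 - p (s j).1.2 ∈ N (s j).1.1 := fun {j l} h =>
      sub_mem_of_le (N := fun j => N (s j).1.1) (x := fun j => p (s j).1.2)
        (fun i j hij => hN (hmono.monotone hij)) h1 h
    have hc : CauchySeq fun j => p (s j).1.2 := by
      refine Metric.cauchySeq_iff'.mpr fun ε hε => ?_
      obtain ⟨n, hn⟩ := exists_nat_one_div_lt hε
      exact ⟨n + 1, fun l hl => (h2 n _ (h3 hl)).trans hn⟩
    obtain ⟨c, hc⟩ := cauchySeq_tendsto_of_complete hc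
    refine ⟨c, fun j => ?_⟩
    refine ((N (s j).1.1).isClosed_of_isOpen (hNo _)).mem_of_tendsto (hc.sub_const _) ?_
    filter_upwards [Filter.eventually_ge_atTop j] with l hl using h3 hl
  obtain ⟨a, ha⟩ := lim Prod.fst (fun j => (hf j (s j)).2.1) (fun j => (hf j (s j)).2.2.2.1)
  obtain ⟨b, hb⟩ := lim Prod.snd (fun j => (hf j (s j)).2.2.1) (fun j => (hf j (s j)).2.2.2.2)
  refine ⟨a - b, fun k => ?_⟩
  have hk : k ≤ (s k).1.1 := hmono.id_le k
  have h1 : a - b - x (s k).1.1 ∈ N (s k).1.1 := by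
    convert add_mem (sub_mem (ha k) (hb k)) (s k).2 using 1
    abel
  simpa using add_mem (hN hk h1) (hx' hk)

/-- By purity, approximate quotients of `x` by `n` modulo the `N k` form a coherent sequence, whose
limit is an exact quotient. -/
theorem isDivisibleGroup_of_dense [PolishSpace A] {N : ℕ → AddSubgroup A}
    (hN : IsOpenPureBasis N) (h : ∀ n : ℕ, 0 < n → ∀ k, ∀ x : A, ∃ y : A, x - n • y ∈ N k) :
    IsDivisibleGroup A := by
  intro n hn x
  choose y hy using fun k => h n hn k x
  obtain ⟨a, ha⟩ := exists_forall_sub_mem hN.antitone hN.isOpen hN.exists_subset (x := y) fun k => by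
    refine hN.pure k n hn _ ?_
    convert sub_mem (hy k) (hN.antitone k.le_succ (hy (k + 1))) using 1
    rw [smul_sub]; abel
  refine ⟨a, sub_eq_zero.mp (hN.eq_zero fun k => ?_)⟩
  convert sub_mem (nsmul_mem (ha k) n) (hy k) using 1
  rw [smul_sub]; abel

omit [IsTopologicalAddGroup A] in
theorem IsOpenPureBasis.isAddTorsionFree [T1Space A] {N : ℕ → AddSubgroup A}
    (hN : IsOpenPureBasis N) : IsAddTorsionFree A where
  nsmul_right_injective n hn x y hxy := by
    refine sub_eq_zero.mp (hN.eq_zero fun k => hN.pure k n (Nat.pos_of_ne_zero hn) _ ?_)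
    have : n • x = n • y := hxy
    simp [smul_sub, this]

end OpenSubgroups

/-! ### Divisible groups as products of rational vector spaces -/

theorem IsDivisibleGroup.nonempty_module_rat {A : Type u} [AddCommGroup A] [IsAddTorsionFree A]
    (hA : IsDivisibleGroup A) : Nonempty (Module ℚ A) := by
  have h : ∀ (q : ℚ) (x : A), ∃ y : A, (q.den : ℤ) • y = q.num • x := fun q x => by
    obtain ⟨y, hy⟩ := hA q.den q.den_pos (q.num • x)
    exact ⟨y, by rw [natCast_zsmul, hy]⟩
  choose f hf using h
  have key : ∀ (q : ℚ) (x : A) (n m : ℤ), n ≠ 0 → q * n = m → n • f q x = m • x := by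
    intro q x n m hn h
    have hd : (q.den : ℤ) ≠ 0 := by exact_mod_cast q.den_ne_zero
    refine zsmul_right_injective hd ?_
    have h' : n * q.num = q.den * m := by
      have : (n * q.num : ℚ) = q.den * m := by
        rw [← h, ← Rat.mul_den_eq_num q]; ring
      exact_mod_cast this
    simp only
    rw [smul_comm, hf, smul_smul, smul_smul, h']
  -- Any fraction `m / n` representing `q`, reduced or not, characterizes `q • x`; the module axioms
  -- then follow by clearing denominators.
  have eq : ∀ (q : ℚ) (x y : A) (n m : ℤ), n ≠ 0 → q * n = m → n • y = m • x → f q x = y :=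
    fun q x y n m hn h hy => zsmul_right_injective hn ((key q x n m hn h).trans hy.symm)
  have hz : ∀ q : ℚ, (q.den : ℤ) ≠ 0 := fun q => by exact_mod_cast q.den_ne_zero
  have hq : ∀ q : ℚ, q * (q.den : ℤ) = q.num := fun q => by exact_mod_cast Rat.mul_den_eq_num q
  let _ : SMul ℚ A := ⟨f⟩
  have hs : ∀ (q : ℚ) (x : A), (q.den : ℤ) • q • x = q.num • x := hf
  exact ⟨Module.ofMinimalAxioms
    (fun q x y => eq q _ _ q.den q.num (hz q) (hq q)
      (by rw [smul_add, hs, hs, smul_add]))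
    (fun q r x => eq (q + r) x _ (q.den * r.den) (q.num * r.den + r.num * q.den)
      (mul_ne_zero (hz q) (hz r)) (by push_cast; rw [← hq, ← hq]; push_cast; ring)
      (by
        rw [smul_add, mul_comm (q.den : ℤ), mul_smul _ _ (q • x), hs, mul_comm (r.den : ℤ),
          mul_smul _ _ (r • x), hs, smul_smul, smul_smul, ← add_smul]
        ring_nf))
    (fun q r x => eq (q * r) x _ (q.den * r.den) (q.num * r.num)
      (mul_ne_zero (hz q) (hz r)) (by push_cast; rw [← hq, ← hq]; push_cast; ring)
      (by
        rw [mul_comm (q.den : ℤ), mul_smul, hs, smul_comm, hs, smul_smul]))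
    (fun x => eq 1 x x 1 1 one_ne_zero (by simp) rfl)⟩

section RatModule

variable {A : Type u} [AddCommGroup A] [Module ℚ A]

/-- Pure subgroups of rational vector spaces are subspaces. -/
def AddSubgroup.toRatSubmodule (N : AddSubgroup A)
    (hN : ∀ n : ℕ, 0 < n → ∀ x : A, n • x ∈ N → x ∈ N) : Submodule ℚ A where
  __ := N
  smul_mem' q x hx := by
    refine hN q.den q.den_pos _ ?_
    have : q.den • q • x = q.num • x := by
      rw [← Nat.cast_smul_eq_nsmul ℚ, smul_smul, Rat.den_mul_eq_num, Int.cast_smul_eq_zsmul]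
    rw [this]
    exact zsmul_mem hx _

/-- A decreasing sequence of subspaces is the sequence of tails of a sequence of pairwise
orthogonal projections. -/
theorem exists_projections (S : ℕ → Submodule ℚ A) (hS : Antitone S) (h0 : S 0 = ⊤) :
    ∃ φ : ℕ → A →ₗ[ℚ] A, (∀ k x, φ k x ∈ S k) ∧ (∀ k, ∀ x ∈ S (k + 1), φ k x = 0) ∧
      (∀ j k x, φ j (φ k x) = if j = k then φ k x else 0) ∧
      ∀ k x, x - ∑ j ∈ Finset.range k, φ j x ∈ S k := by
  have : ∀ k, ∃ r : A →ₗ[ℚ] A, (∀ x, r x ∈ S k) ∧ ∀ x ∈ S k, r x = x := by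
    intro k
    obtain ⟨p, hp⟩ := (S k).subtype.exists_leftInverse_of_injective (S k).ker_subtype
    exact ⟨(S k).subtype ∘ₗ p, fun x => (p x).2, fun x hx =>
      congrArg Subtype.val (LinearMap.congr_fun hp ⟨x, hx⟩)⟩
  choose r hr hr' using this
  -- Composing the retractions makes the kernels increase with `k`, whence `R l ∘ R k = R l` for `k
  -- ≤ l`; unrelated retractions would not give orthogonal differences.
  let R : ℕ → A →ₗ[ℚ] A := fun k => Nat.rec LinearMap.id (fun k f => r (k + 1) ∘ₗ f) k
  have R0 : ∀ x, R 0 x = x := fun x => rfl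
  have Rs : ∀ k x, R (k + 1) x = r (k + 1) (R k x) := fun k x => rfl
  have Rmem : ∀ k x, R k x ∈ S k := by
    rintro (_ | k) x
    · simp [h0]
    · exact hr _ _
  have Rid : ∀ k, ∀ x ∈ S k, R k x = x := by
    intro k
    induction k with
    | zero => exact fun x _ => R0 x
    | succ k ih =>
      intro x hx
      rw [Rs, ih x (hS k.le_succ hx), hr' _ x hx]
  have RR : ∀ k l x, k ≤ l → R l (R k x) = R l x := by
    intro k l x hkl
    induction l, hkl using Nat.le_induction with
    | base => exact Rid k _ (Rmem k x)
    | succ l hl ih => rw [Rs, ih, Rs]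
  have φmem : ∀ k x, (R k - R (k + 1)) x ∈ S k := fun k x =>
    sub_mem (Rmem k x) (hS k.le_succ (Rmem _ x))
  have φz : ∀ k, ∀ x ∈ S (k + 1), (R k - R (k + 1)) x = 0 := fun k x hx => by
    rw [LinearMap.sub_apply, Rid _ x hx, Rid _ x (hS k.le_succ hx), sub_self]
  have Rφ : ∀ j k x, k < j → R j ((R k - R (k + 1)) x) = 0 := fun j k x h => by
    rw [LinearMap.sub_apply, map_sub, RR _ _ _ h.le, RR _ _ _ h, sub_self]
  refine ⟨fun k => R k - R (k + 1), φmem, φz, fun j k x => ?_, fun k x => ?_⟩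
  · rcases lt_trichotomy j k with h | rfl | h
    · rw [if_neg h.ne]
      exact φz j _ (hS h (φmem k x))
    · rw [if_pos rfl, LinearMap.sub_apply (R j), Rφ _ _ _ j.lt_succ_self, sub_zero,
        Rid _ _ (φmem j x)]
    · rw [if_neg h.ne', LinearMap.sub_apply (R j), Rφ _ _ _ h, Rφ _ _ _ (h.trans j.lt_succ_self),
        sub_zero]
  · have : ∑ j ∈ Finset.range k, (R j - R (j + 1)) x = R 0 x - R k x := by
      simpa using Finset.sum_range_sub' (fun j => R j x) k
    rw [this, R0, sub_sub_cancel]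
    exact Rmem k x

end RatModule

/-- A divisible Polish abelian group with a basis of open pure subgroups is a product of
countable rational vector spaces. -/
theorem IsOpenPureBasis.exists_equiv_pi {A : Type u} [AddCommGroup A] [TopologicalSpace A]
    [IsTopologicalAddGroup A] [PolishSpace A] {N : ℕ → AddSubgroup A} (hN : IsOpenPureBasis N)
    (hA : IsDivisibleGroup A) :
    ∃ (C : ℕ → Type u) (_ : ∀ k, AddCommGroup (C k)) (_ : ∀ k, Module ℚ (C k))
      (_ : ∀ k, Countable (C k)), Nonempty (A ≃ₜ+ ∀ k, DiscreteCopy (C k)) := by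
  have := hN.isAddTorsionFree
  obtain ⟨_⟩ := hA.nonempty_module_rat
  -- The whole space is prepended so that the quotient by `N 0` is also counted as a factor.
  let S : ℕ → Submodule ℚ A := fun k => Nat.rec ⊤ (fun k _ => (N k).toRatSubmodule (hN.pure k)) k
  have hS0 : S 0 = ⊤ := rfl
  have hSo : ∀ k, IsOpen ((S k).toAddSubgroup : Set A) := by
    rintro (_ | k)
    · exact isOpen_univ
    · exact hN.isOpen k
  have hS : Antitone S := by
    refine antitone_nat_of_succ_le ?_
    rintro (_ | k)
    · exact le_top
    · exact hN.antitone k.le_succ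
  have hSb : ∀ U ∈ nhds (0 : A), ∃ k, ((S k).toAddSubgroup : Set A) ⊆ U := fun U hU => by
    obtain ⟨k, hk⟩ := hN.exists_subset U hU
    exact ⟨k + 1, hk⟩
  obtain ⟨φ, h1, h2, h3, h4⟩ := exists_projections S hS hS0
  have hcount : ∀ k, Countable (LinearMap.range (φ k)) := by
    intro k
    have := countable_quotient_of_isOpen (hSo (k + 1))
    refine Function.Surjective.countable
      (f := QuotientAddGroup.lift (S (k + 1)).toAddSubgroup (φ k).rangeRestrict.toAddMonoidHom ?_) ?_
    · exact fun x hx => Subtype.ext (h2 k x hx)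
    · exact QuotientAddGroup.lift_surjective_of_surjective _ _ (φ k).surjective_rangeRestrict _
  refine ⟨fun k => LinearMap.range (φ k), inferInstance, inferInstance, hcount, ⟨?_⟩⟩
  let Φ : A →+ ∀ k, DiscreteCopy (LinearMap.range (φ k)) :=
    { toFun := fun x k => (φ k).rangeRestrict x
      map_zero' := funext fun k => map_zero (φ k).rangeRestrict
      map_add' := fun x y => funext fun k => map_add (φ k).rangeRestrict x y }
  have hΦ : ∀ x k, (show LinearMap.range (φ k) from Φ x k).1 = φ k x := fun x k => rfl
  have hmem : ∀ k x, (∀ j < k, Φ x j = 0) → x ∈ S k := fun k x hx => by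
    have := h4 k x
    rwa [Finset.sum_eq_zero, sub_zero] at this
    intro j hj
    exact congrArg Subtype.val (hx j (Finset.mem_range.mp hj))
  have hcont : Continuous Φ := by
    refine continuous_pi fun k => ?_
    let Φk : A →+ DiscreteCopy (LinearMap.range (φ k)) := (Pi.evalAddMonoidHom _ k).comp Φ
    change Continuous Φk
    refine continuous_of_continuousAt_zero Φk ?_
    have : ∀ᶠ x in nhds 0, Φk x = 0 := by
      filter_upwards [(hSo (k + 1)).mem_nhds (zero_mem _)] with x hx
      exact Subtype.ext (h2 k x hx)
    rw [ContinuousAt, map_zero]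
    exact Filter.Tendsto.congr' (this.mono fun _ h => h.symm) tendsto_const_nhds
  have hinj : Function.Injective Φ := by
    rw [injective_iff_map_eq_zero]
    exact fun x hx => hN.eq_zero fun k => hmem (k + 1) x fun j _ => congrFun hx j
  have hsurj : Function.Surjective Φ := by
    intro c
    have hc : ∀ k, ∃ x, φ k x = (show LinearMap.range (φ k) from c k).1 := fun k =>
      (show LinearMap.range (φ k) from c k).2
    choose x hx using hc
    -- Completeness sums the series of prescribed components.
    obtain ⟨a, ha⟩ := exists_forall_sub_mem (fun i j h => hS h) hSo hSb
      (x := fun k => ∑ j ∈ Finset.range k, φ j (x j)) fun k => by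
        rw [Finset.sum_range_succ, add_sub_cancel_left]
        exact h1 k _
    refine ⟨a, funext fun k => Subtype.ext ?_⟩
    have := h2 k _ (ha (k + 1))
    rw [map_sub, sub_eq_zero] at this
    rw [hΦ, this, map_sum, Finset.sum_congr rfl fun j _ => h3 k j (x j), Finset.sum_ite_eq,
      if_pos (Finset.self_mem_range_succ k), hx]
  have hopen : IsOpenMap Φ := by
    rw [IsTopologicalAddGroup.isOpenMap_iff_nhds_zero]
    intro U hU
    obtain ⟨k, hk⟩ := hSb _ hU
    have : ∀ᶠ y : ∀ k, DiscreteCopy (LinearMap.range (φ k)) in nhds 0, ∀ j ∈ Finset.range k, y j = 0 := by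
      rw [Finset.eventually_all]
      exact fun j _ => (continuous_apply j).continuousAt.eventually
        ((isOpen_discrete {0}).mem_nhds rfl)
    filter_upwards [this] with y hy
    obtain ⟨x, rfl⟩ := hsurj y
    exact hk (hmem k x fun j hj => hy j (Finset.mem_range.mpr hj))
  exact { AddEquiv.ofBijective Φ ⟨hinj, hsurj⟩,
    (Equiv.ofBijective Φ ⟨hinj, hsurj⟩).toHomeomorphOfContinuousOpen hcont hopen with }

/-! ### The normal form -/

theorem exists_equiv_ordIndex (I : Type*) [Countable I] :
    ∃ α : ℕ∞, Nonempty (I ≃ OrdIndex α) := by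
  rcases finite_or_infinite I with h | h
  · obtain ⟨n, ⟨e⟩⟩ := Finite.exists_equiv_fin I
    refine ⟨n, ⟨e.trans (Fin.equivSubtype.trans (Equiv.subtypeEquivRight fun k => ?_))⟩⟩
    exact Nat.cast_lt.symm
  · obtain ⟨e⟩ := nonempty_equiv_of_countable (α := I) (β := ℕ)
    exact ⟨⊤, ⟨e.trans (Equiv.subtypeUnivEquiv fun k => ENat.natCast_lt_top k).symm⟩⟩

theorem exists_addEquiv_of_countable (V : Type*) [AddCommGroup V] [Module ℚ V] [Countable V] :
    (∃ d : ℕ, Nonempty (V ≃+ (Fin d → ℚ))) ∨ Nonempty (V ≃+ (ℕ →₀ ℚ)) := by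
  let b := Module.Basis.ofVectorSpace ℚ V
  rcases finite_or_infinite (Module.Basis.ofVectorSpaceIndex ℚ V) with h | h
  · obtain ⟨n, ⟨e⟩⟩ := Finite.exists_equiv_fin (Module.Basis.ofVectorSpaceIndex ℚ V)
    exact .inl ⟨n, ⟨(b.reindex e).equivFun.toAddEquiv⟩⟩
  · obtain ⟨e⟩ := nonempty_equiv_of_countable (α := Module.Basis.ofVectorSpaceIndex ℚ V) (β := ℕ)
    exact .inr ⟨(b.reindex e).repr.toAddEquiv⟩

namespace ContinuousAddEquiv

/-- An isomorphism of discrete groups. -/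
def ofDiscrete {X Y : Type*} [Add X] [Add Y] [TopologicalSpace X] [TopologicalSpace Y]
    [DiscreteTopology X] [DiscreteTopology Y] (e : X ≃+ Y) : X ≃ₜ+ Y where
  __ := e
  continuous_toFun := continuous_of_discreteTopology
  continuous_invFun := continuous_of_discreteTopology

/-- Products of isomorphic groups are isomorphic. -/
def piCongrRight {ι : Type*} {X Y : ι → Type*} [∀ i, Add (X i)] [∀ i, Add (Y i)]
    [∀ i, TopologicalSpace (X i)] [∀ i, TopologicalSpace (Y i)] (e : ∀ i, X i ≃ₜ+ Y i) :
    (∀ i, X i) ≃ₜ+ ∀ i, Y i :=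
  .mk' (Homeomorph.piCongrRight fun i => (e i).toHomeomorph)
    fun x y => funext fun i => map_add (e i) (x i) (y i)

/-- Binary products of isomorphic groups are isomorphic. -/
def prodCongr {X Y Z W : Type*} [Add X] [Add Y] [Add Z] [Add W] [TopologicalSpace X]
    [TopologicalSpace Y] [TopologicalSpace Z] [TopologicalSpace W] (e : X ≃ₜ+ Y) (f : Z ≃ₜ+ W) :
    X × Z ≃ₜ+ Y × W :=
  .mk' (e.toHomeomorph.prodCongr f.toHomeomorph)
    fun x y => Prod.ext (map_add e x.1 y.1) (map_add f x.2 y.2)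

/-- Reindexing a power. -/
def powCongr {ι κ : Type*} (X : Type*) [Add X] [TopologicalSpace X] (e : ι ≃ κ) :
    (ι → X) ≃ₜ+ (κ → X) where
  toFun x k := x (e.symm k)
  invFun y i := y (e i)
  left_inv x := by simp
  right_inv y := by simp
  map_add' _ _ := rfl
  continuous_toFun := by fun_prop
  continuous_invFun := by fun_prop

/-- A product of powers is a power. -/
def piPow {ι : Type*} (κ : ι → Type*) (X : Type*) [Add X] [TopologicalSpace X] :
    (∀ i, κ i → X) ≃ₜ+ ((Σ i, κ i) → X) where
  toFun x p := x p.1 p.2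
  invFun y i k := y ⟨i, k⟩
  left_inv _ := rfl
  right_inv _ := rfl
  map_add' _ _ := rfl
  continuous_toFun := by fun_prop
  continuous_invFun := by fun_prop

/-- Splitting the index set of a product. -/
def piSplit {ι : Type*} (p : ι → Prop) [DecidablePred p] (X : ι → Type*) [∀ i, Add (X i)]
    [∀ i, TopologicalSpace (X i)] :
    (∀ i, X i) ≃ₜ+ (∀ i : {i // p i}, X i) × ∀ i : {i // ¬p i}, X i :=
  .mk' (Homeomorph.piEquivPiSubtypeProd p X) fun _ _ => rfl

end ContinuousAddEquiv

open ContinuousAddEquiv in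
-- Bases of the finite-dimensional factors are pooled into one power of `ℚ`; each remaining factor
-- is a copy of `ℕ →₀ ℚ`.
theorem exists_equiv_prod_of_pi (C : ℕ → Type u) [∀ k, AddCommGroup (C k)] [∀ k, Module ℚ (C k)]
    [∀ k, Countable (C k)] :
    ∃ α β : ℕ∞, Nonempty ((∀ k, DiscreteCopy (C k)) ≃ₜ+
      (OrdIndex α → DiscreteCopy ℚ) × (OrdIndex β → DiscreteCopy (ℕ →₀ ℚ))) := by
  classical
  let p : ℕ → Prop := fun k => ∃ d : ℕ, Nonempty (C k ≃+ (Fin d → ℚ))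
  have hp : ∀ k : {k // p k}, ∃ d : ℕ, Nonempty (C k ≃+ (Fin d → ℚ)) := fun k => k.2
  have hq : ∀ k : {k // ¬p k}, Nonempty (C k ≃+ (ℕ →₀ ℚ)) := fun k =>
    (exists_addEquiv_of_countable (C k)).resolve_left k.2
  choose d hd using hp
  obtain ⟨α, ⟨eα⟩⟩ := exists_equiv_ordIndex (Σ k : {k // p k}, Fin (d k))
  obtain ⟨β, ⟨eβ⟩⟩ := exists_equiv_ordIndex {k // ¬p k}
  have e₁ : ∀ k : {k // p k}, DiscreteCopy (C k) ≃ₜ+ (Fin (d k) → DiscreteCopy ℚ) := fun k =>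
    ofDiscrete (show C k ≃+ (Fin (d k) → ℚ) from (hd k).some)
  have e₂ : ∀ k : {k // ¬p k}, DiscreteCopy (C k) ≃ₜ+ DiscreteCopy (ℕ →₀ ℚ) := fun k =>
    ofDiscrete (show C k ≃+ (ℕ →₀ ℚ) from (hq k).some)
  exact ⟨α, β, ⟨(piSplit p _).trans <| prodCongr
    ((piCongrRight e₁).trans <| (piPow _ _).trans <| powCongr _ eα)
    ((piCongrRight e₂).trans <| powCongr _ eβ)⟩⟩

theorem IsDivisibleGroup.exists_equiv {A : Type u} [AddCommGroup A] [TopologicalSpace A]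
    [IsTopologicalAddGroup A] [PolishSpace A] (hA : IsProLieAb A) (hZ : IsTypeZ A)
    (hdiv : IsDivisibleGroup A) :
    ∃ α β : ℕ∞, Nonempty (A ≃ₜ+
      (OrdIndex α → DiscreteCopy ℚ) × (OrdIndex β → DiscreteCopy (ℕ →₀ ℚ))) := by
  obtain ⟨N, hN⟩ := exists_isOpenPureBasis hA hZ
  obtain ⟨C, _, _, _, ⟨e⟩⟩ := hN.exists_equiv_pi hdiv
  obtain ⟨α, β, ⟨f⟩⟩ := exists_equiv_prod_of_pi C
  exact ⟨α, β, ⟨e.trans f⟩⟩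

/-! ### Extension of continuous homomorphisms -/

/-- Since `h` vanishes on the preimage of some open subgroup `W` of `Y`, it factors through a
subgroup of `Y ⧸ W`. Divisibility of `V` extends it to `Y ⧸ W`, where continuity is automatic. -/
theorem exists_extension_of_discrete {X Y V : Type*} [AddCommGroup X] [TopologicalSpace X]
    [AddCommGroup Y] [TopologicalSpace Y] [IsTopologicalAddGroup Y]
    [AddCommGroup V] [TopologicalSpace V] [DiscreteTopology V] [Module ℚ V]
    (hY : ∀ U ∈ nhds (0 : Y), ∃ W : AddSubgroup Y, IsOpen (W : Set Y) ∧ (W : Set Y) ⊆ U)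
    (f : X →ₜ+ Y) (hf : Filter.comap f (nhds 0) ≤ nhds 0) (h : X →ₜ+ V) :
    ∃ g : Y →ₜ+ V, ∀ x, g (f x) = h x := by
  have hV : Module.Baer ℤ V := by
    let _ : DivisibleBy V ℤ :=
      { div := fun x n => (n : ℚ)⁻¹ • x
        div_zero := fun x => by simp
        div_cancel := fun {n} x hn => by
          rw [← Int.cast_smul_eq_zsmul ℚ, smul_smul, mul_inv_cancel₀ (by exact_mod_cast hn),
            one_smul] }
    exact Module.Baer.of_divisible V
  have hk : h ⁻¹' {0} ∈ nhds (0 : X) :=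
    (map_continuous h).continuousAt.preimage_mem_nhds (by simp)
  obtain ⟨U, hU, hUk⟩ := hf hk
  obtain ⟨W, hWo, hWU⟩ := hY U hU
  let F : X →+ Y ⧸ W := (QuotientAddGroup.mk' W).comp f.toAddMonoidHom
  have hF : F.ker ≤ h.toAddMonoidHom.ker := fun x hx =>
    hUk (hWU ((QuotientAddGroup.eq_zero_iff _).mp hx))
  obtain ⟨g, hg⟩ := hV.extension_property_addMonoidHom (QuotientAddGroup.kerLift F)
    (QuotientAddGroup.kerLift_injective F) (QuotientAddGroup.lift F.ker h.toAddMonoidHom hF)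
  have := QuotientAddGroup.discreteTopology hWo
  exact ⟨⟨g.comp (QuotientAddGroup.mk' W),
    (continuous_of_discreteTopology (f := g)).comp QuotientAddGroup.continuous_mk⟩, fun x =>
      DFunLike.congr_fun hg (x : X ⧸ F.ker)⟩

theorem exists_extension {X Y B : Type*} [AddCommGroup X] [TopologicalSpace X]
    [AddCommGroup Y] [TopologicalSpace Y] [IsTopologicalAddGroup Y]
    [AddCommGroup B] [TopologicalSpace B]
    {ι κ V W : Type*} [AddCommGroup V] [TopologicalSpace V] [DiscreteTopology V] [Module ℚ V]
    [AddCommGroup W] [TopologicalSpace W] [DiscreteTopology W] [Module ℚ W]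
    (e : B ≃ₜ+ (ι → V) × (κ → W))
    (hY : ∀ U ∈ nhds (0 : Y), ∃ W : AddSubgroup Y, IsOpen (W : Set Y) ∧ (W : Set Y) ⊆ U)
    (f : X →ₜ+ Y) (hf : Filter.comap f (nhds 0) ≤ nhds 0) (h : X →ₜ+ B) :
    ∃ g : Y →ₜ+ B, ∀ x, g (f x) = h x := by
  have h₁ : ∀ i, ∃ g : Y →ₜ+ V, ∀ x, g (f x) = (e (h x)).1 i := fun i =>
    exists_extension_of_discrete hY f hf
      { toFun := fun x => (e (h x)).1 i
        map_zero' := by simp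
        map_add' := by simp
        continuous_toFun := by
          have := map_continuous h
          have := map_continuous e
          fun_prop }
  have h₂ : ∀ i, ∃ g : Y →ₜ+ W, ∀ x, g (f x) = (e (h x)).2 i := fun i =>
    exists_extension_of_discrete hY f hf
      { toFun := fun x => (e (h x)).2 i
        map_zero' := by simp
        map_add' := by simp
        continuous_toFun := by
          have := map_continuous h
          have := map_continuous e
          fun_prop }
  choose g₁ hg₁ using h₁
  choose g₂ hg₂ using h₂
  refine ⟨{ toFun := fun y => e.symm (fun i => g₁ i y, fun i => g₂ i y)
            map_zero' := ?_
            map_add' := fun y z => ?_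
            continuous_toFun := ?_ }, fun x => ?_⟩
  · simp only [map_zero]; exact map_zero e.symm
  · simp only [map_add]
    exact map_add e.symm (fun i => g₁ i y, fun i => g₂ i y) (fun i => g₁ i z, fun i => g₂ i z)
  · exact (map_continuous e.symm).comp (.prodMk (continuous_pi fun i => map_continuous (g₁ i))
      (continuous_pi fun i => map_continuous (g₂ i)))
  · change e.symm _ = _
    simp only [hg₁, hg₂]
    exact e.symm_apply_apply _

/-! ### Short exact sequences and injectivity -/

namespace ProLiePAbZ

/-- The continuous homomorphism underlying a morphism of `ProLiePAbZ`. -/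
def Hom.toFun {A B : ProLiePAbZ.{u}} (f : A ⟶ B) : A.toPAb →ₜ+ B.toPAb := f.hom.hom

/-- The morphism of `ProLiePAb` given by a continuous homomorphism. -/
def proLieHom {A B : ProLiePAb.{u}} (f : A.obj →ₜ+ B.obj) : A ⟶ B := ⟨f⟩

/-- The morphism of `ProLiePAbZ` given by a continuous homomorphism. -/
def ofHom {A B : ProLiePAbZ.{u}} (f : A.toPAb →ₜ+ B.toPAb) : A ⟶ B := ⟨⟨f⟩⟩

theorem hom_ext' {A B : ProLiePAbZ.{u}} {f g : A ⟶ B} (h : ∀ x, Hom.toFun f x = Hom.toFun g x) :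
    f = g :=
  ObjectProperty.hom_ext _ (ObjectProperty.hom_ext _ (ContinuousAddMonoidHom.ext h))

theorem exists_isOpen_subgroup (A : ProLiePAbZ.{u}) : ∀ U ∈ nhds (0 : A.toPAb),
    ∃ W : AddSubgroup A.toPAb, IsOpen (W : Set A.toPAb) ∧ (W : Set A.toPAb) ⊆ U := fun _ hU =>
  let ⟨N, h₁, h₂, _⟩ := exists_isOpen_pure_subset A.obj.property A.property hU
  ⟨N, h₁, h₂⟩

/-- Closed subgroups of a type `ℤ` group, as objects of `ProLiePAb`. -/
def closedSubgroup (A : ProLiePAbZ.{u}) (K : AddSubgroup A.toPAb)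
    (hK : IsClosed (K : Set A.toPAb)) : ProLiePAb.{u} where
  obj :=
    { carrier := K
      polishSpace := hK.polishSpace }
  property := by
    have : PolishSpace K := hK.polishSpace
    intro U hU
    obtain ⟨U', hU', hUU⟩ := (mem_nhds_subtype _ _ _).mp hU
    obtain ⟨W, hWo, hWU⟩ := A.exists_isOpen_subgroup U' hU'
    refine ⟨W.addSubgroupOf K, mem_coLie_of_isOpen (A := K) ?_, fun x hx => hUU (hWU hx)⟩
    exact hWo.preimage continuous_subtype_val

/-- The kernel in a short exact sequence carries the subspace topology. -/
theorem IsShortExact.comap_le {S : ShortComplex ProLiePAbZ.{u}} (hS : IsShortExact S) :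
    Filter.comap (Hom.toFun S.f) (nhds 0) ≤ nhds 0 := by
  obtain ⟨⟨hl⟩, -⟩ := hS
  let g : S.X₂.toPAb →ₜ+ S.X₃.toPAb := Hom.toFun S.g
  let K : AddSubgroup S.X₂.toPAb := g.toAddMonoidHom.ker
  have hK : IsClosed (K : Set S.X₂.toPAb) := isClosed_singleton.preimage (map_continuous g)
  -- The universal property of `S.f` is tested on the set-theoretic kernel of `g` with its subspace
  -- topology; the resulting `l` is a continuous left inverse of the corestriction of `S.f`.
  let Ko := closedSubgroup S.X₂ K hK
  let i : Ko ⟶ S.X₂.obj := proLieHom (A := Ko) (B := S.X₂.obj)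
    ⟨K.subtype, continuous_subtype_val⟩
  have hgf : ∀ x, g (Hom.toFun S.f x) = 0 := fun x =>
    congrArg (fun φ : S.X₁ ⟶ S.X₃ => Hom.toFun φ x) S.zero
  have hi : i ≫ (S.map (typeZ.{u}).ι).g = 0 :=
    ObjectProperty.hom_ext _ (ContinuousAddMonoidHom.ext fun x => x.2)
  let l : Ko ⟶ S.X₁.obj := hl.lift (KernelFork.ofι i hi)
  have hli : l ≫ S.f.hom = i := hl.fac (KernelFork.ofι i hi) WalkingParallelPair.zero
  let c : S.X₁.obj ⟶ Ko := proLieHom (B := Ko)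
    { toFun := fun x => ⟨Hom.toFun S.f x, hgf x⟩
      map_zero' := Subtype.ext (map_zero (Hom.toFun S.f))
      map_add' := fun x y => Subtype.ext (map_add (Hom.toFun S.f) x y)
      continuous_toFun := (map_continuous (Hom.toFun S.f)).subtype_mk _ }
  have hci : c ≫ i = S.f.hom := rfl
  have hcl : c ≫ l = 𝟙 S.X₁.obj := Fork.IsLimit.hom_ext hl (by
    change (c ≫ l) ≫ S.f.hom = 𝟙 _ ≫ S.f.hom
    rw [Category.assoc, hli, hci, Category.id_comp])
  let lf : K →ₜ+ S.X₁.toPAb := l.hom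
  have hlf : ∀ x, lf ⟨Hom.toFun S.f x, hgf x⟩ = x := fun x =>
    congrArg (fun φ : S.X₁.obj ⟶ S.X₁.obj => (show S.X₁.toPAb →ₜ+ S.X₁.toPAb from φ.hom) x) hcl
  intro U hU
  have : lf ⁻¹' U ∈ nhds (0 : K) :=
    (map_continuous lf).continuousAt.preimage_mem_nhds (by rwa [map_zero])
  obtain ⟨V, hV, hVU⟩ := (mem_nhds_subtype _ _ _).mp this
  refine ⟨V, hV, fun x hx => ?_⟩
  have := hVU (show (⟨Hom.toFun S.f x, hgf x⟩ : K) ∈ Subtype.val ⁻¹' V from hx)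
  rwa [Set.mem_preimage, hlf] at this

/-- Left exactness is the universal property of the cokernel. -/
theorem isInjective_of_surjective {I : ProLiePAbZ.{u}}
    (h : ∀ S : ShortComplex ProLiePAbZ.{u}, IsShortExact S →
      Function.Surjective (fun h : S.X₂ ⟶ I => S.f ≫ h)) : IsInjective I := by
  intro S hS
  obtain ⟨-, ⟨hc⟩⟩ := id hS
  refine ⟨fun a b hab => ?_, fun k => ⟨fun hk => ?_, ?_⟩, h S hS⟩
  · exact ObjectProperty.hom_ext _ (Cofork.IsColimit.hom_ext hc
      (congrArg InducedCategory.Hom.hom hab))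
  · have hk' : (S.map (typeZ.{u}).ι).f ≫ k.hom = 0 := congrArg InducedCategory.Hom.hom hk
    exact ⟨⟨hc.desc (CokernelCofork.ofπ k.hom hk')⟩, ObjectProperty.hom_ext _
      (hc.fac (CokernelCofork.ofπ k.hom hk') WalkingParallelPair.one)⟩
  · rintro ⟨m, rfl⟩
    change S.f ≫ S.g ≫ m = 0
    rw [← Category.assoc, S.zero, zero_comp]

theorem isInjective_of_equiv {I : ProLiePAbZ.{u}} {ι κ V W : Type*} [AddCommGroup V]
    [TopologicalSpace V] [DiscreteTopology V] [Module ℚ V] [AddCommGroup W] [TopologicalSpace W]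
    [DiscreteTopology W] [Module ℚ W] (e : I.toPAb ≃ₜ+ (ι → V) × (κ → W)) : IsInjective I :=
  isInjective_of_surjective fun S hS h => by
    obtain ⟨g, hg⟩ := exists_extension e S.X₂.exists_isOpen_subgroup (Hom.toFun S.f) hS.comap_le
      (Hom.toFun h)
    exact ⟨ofHom g, hom_ext' hg⟩

/-- Countable torsion-free groups, with the discrete topology. -/
def discrete (D : Type u) [AddCommGroup D] [Countable D] [IsAddTorsionFree D] :
    ProLiePAbZ.{u} where
  obj :=
    { obj :=
        { carrier := DiscreteCopy D
          polishSpace :=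
            have : Countable (DiscreteCopy D) := inferInstanceAs (Countable D)
            inferInstance }
      property :=
        have : Countable (DiscreteCopy D) := inferInstanceAs (Countable D)
        isProLieAb_of_discrete (DiscreteCopy D) }
  property :=
    have : Countable (DiscreteCopy D) := inferInstanceAs (Countable D)
    have : IsAddTorsionFree (DiscreteCopy D) := inferInstanceAs (IsAddTorsionFree D)
    isTypeZ_of_discrete (DiscreteCopy D)

/-- Homomorphisms out of a discrete group are continuous. -/
def ofDiscrete (D : Type u) [AddCommGroup D] [Countable D] [IsAddTorsionFree D]
    {B : ProLiePAb.{u}} (f : D →+ B.obj) : (discrete D).obj ⟶ B :=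
  ⟨⟨f, continuous_of_discreteTopology (α := DiscreteCopy D)⟩⟩

section DiscreteSequence

variable {D₁ D₂ D₃ : Type u} [AddCommGroup D₁] [Countable D₁] [IsAddTorsionFree D₁]
  [AddCommGroup D₂] [Countable D₂] [IsAddTorsionFree D₂]
  [AddCommGroup D₃] [Countable D₃] [IsAddTorsionFree D₃]

/-- A complex of countable discrete torsion-free groups. -/
def discreteComplex (f : D₁ →+ D₂) (g : D₂ →+ D₃) (h : ∀ x, g (f x) = 0) :
    ShortComplex ProLiePAbZ.{u} where
  X₁ := discrete D₁
  X₂ := discrete D₂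
  X₃ := discrete D₃
  f := ⟨ofDiscrete D₁ (B := (discrete D₂).obj) f⟩
  g := ⟨ofDiscrete D₂ (B := (discrete D₃).obj) g⟩
  zero := hom_ext' h

/-- Algebraic factorizations are automatically continuous: for the kernel, preimages under the lift
are preimages of subsets of the discrete `D₂`; for the cokernel, the source is discrete. -/
theorem isShortExact_discreteComplex {f : D₁ →+ D₂} {g : D₂ →+ D₃} (hf : Function.Injective f)
    (hg : Function.Surjective g) (hfg : ∀ y, g y = 0 ↔ y ∈ Set.range f) :
    IsShortExact (discreteComplex f g fun x => (hfg _).mpr ⟨x, rfl⟩) := by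
  have hc : ∀ {B : ProLiePAb.{u}} {D : Type u} [AddCommGroup D] [Countable D]
      [IsAddTorsionFree D] {a b : (discrete D).obj ⟶ B},
      (∀ x : D, (show DiscreteCopy D →ₜ+ B.obj from a.hom) x =
        (show DiscreteCopy D →ₜ+ B.obj from b.hom) x) → a = b := fun h =>
    ObjectProperty.hom_ext _ (ContinuousAddMonoidHom.ext h)
  constructor
  · have : Mono (ofDiscrete D₁ (B := (discrete D₂).obj) f) := ⟨fun a b hab =>
      ObjectProperty.hom_ext _ (ContinuousAddMonoidHom.ext fun x => hf
        (congrArg (fun φ : _ ⟶ (discrete D₂).obj => (show _ →ₜ+ DiscreteCopy D₂ from φ.hom) x) hab))⟩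
    have : Mono ((discreteComplex f g fun x => (hfg _).mpr ⟨x, rfl⟩).map (typeZ.{u}).ι).f := this
    refine ⟨KernelFork.IsLimit.ofι' _ _ fun {B} k hk => ?_⟩
    let k' : B.obj →ₜ+ DiscreteCopy D₂ := k.hom
    have hk' : ∀ b, ∃ x, f x = k' b := fun b => (hfg _).mp
      (congrArg (fun φ : B ⟶ (discrete D₃).obj =>
        (show B.obj →ₜ+ DiscreteCopy D₃ from φ.hom) b) hk)
    choose l hl using hk'
    have hlo : ∀ U : Set D₁, IsOpen (l ⁻¹' U) := fun U => by
      have : l ⁻¹' U = k' ⁻¹' (f '' U) := by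
        ext b
        rw [Set.mem_preimage, Set.mem_preimage, ← hl]
        exact hf.mem_set_image.symm
      rw [this]
      exact (isOpen_discrete (α := DiscreteCopy D₂) _).preimage (map_continuous k')
    refine ⟨proLieHom (B := (discrete D₁).obj)
      { toFun := l
        map_zero' := hf (by rw [hl, map_zero]; exact (map_zero f).symm)
        map_add' := fun x y => hf (by
          rw [hl, map_add]; exact ((map_add f _ _).trans (by rw [hl, hl]; rfl)).symm)
        continuous_toFun := continuous_def.mpr fun U _ => hlo U }, ?_⟩
    exact ObjectProperty.hom_ext _ (ContinuousAddMonoidHom.ext hl)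
  · have : Epi (ofDiscrete D₂ (B := (discrete D₃).obj) g) := ⟨fun {Z} a b hab => hc fun x => by
      obtain ⟨y, rfl⟩ := hg x
      exact congrArg (fun φ : (discrete D₂).obj ⟶ Z =>
        (show DiscreteCopy D₂ →ₜ+ Z.obj from φ.hom) y) hab⟩
    have : Epi ((discreteComplex f g fun x => (hfg _).mpr ⟨x, rfl⟩).map (typeZ.{u}).ι).g := this
    refine ⟨CokernelCofork.IsColimit.ofπ' _ _ fun {B} k hk => ?_⟩
    let k' : D₂ →+ B.obj := (show DiscreteCopy D₂ →ₜ+ B.obj from k.hom).toAddMonoidHom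
    have hk' : ∀ x, k' (f x) = 0 := fun x =>
      congrArg (fun φ : (discrete D₁).obj ⟶ B =>
        (show DiscreteCopy D₁ →ₜ+ B.obj from φ.hom) x) hk
    have hker : g.ker ≤ k'.ker := fun y hy => by
      obtain ⟨x, rfl⟩ := (hfg y).mp hy
      exact hk' x
    refine ⟨ofDiscrete D₃ (g.liftOfSurjective hg ⟨k', hker⟩), hc fun x => ?_⟩
    exact g.liftOfRightInverse_comp_apply _ (Function.rightInverse_surjInv hg) ⟨k', hker⟩ x

end DiscreteSequence

end ProLiePAbZ

/-! ### Extensions of `ℤ[1/n]` and divisibility -/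

open Polynomial in
-- Gauss's lemma: `1 - nX` is primitive because its constant term is 1, and over `ℚ` it is
-- associated to `X - 1/n`.
theorem aeval_inv_eq_zero_iff {n : ℕ} (hn : 0 < n) (p : ℤ[X]) :
    aeval (n : ℚ)⁻¹ p = 0 ↔ p ∈ Set.range fun q : ℤ[X] => (1 - C (n : ℤ) * X) * q := by
  have hn' : (n : ℚ) ≠ 0 := by exact_mod_cast hn.ne'
  constructor
  · intro hp
    have hprim : (1 - C (n : ℤ) * X : ℤ[X]).IsPrimitive := fun r hr => by
      have := (C_dvd_iff_dvd_coeff _ _).mp hr 0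
      simp only [coeff_sub, coeff_one_zero, mul_coeff_zero, coeff_X_zero, mul_zero,
        sub_zero] at this
      exact isUnit_of_dvd_one this
    obtain ⟨q, hq⟩ : 1 - C (n : ℤ) * X ∣ p := by
      rw [IsPrimitive.Int.dvd_iff_map_cast_dvd_map_cast _ _ hprim]
      have h : X - C (n : ℚ)⁻¹ ∣ p.map (Int.castRingHom ℚ) :=
        dvd_iff_isRoot.mpr (by rwa [IsRoot, Polynomial.eval_map, ← algebraMap_int_eq])
      refine (Dvd.intro_left (C (-n : ℚ)⁻¹) ?_).trans h
      simp only [Polynomial.map_sub, Polynomial.map_mul, map_X, map_C, Polynomial.map_one]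
      rw [mul_sub, ← mul_assoc, ← C_mul, inv_neg]
      simp [hn']
      ring
    exact ⟨q, hq.symm⟩
  · rintro ⟨q, rfl⟩
    simp [hn']

namespace ProLiePAbZ

open Polynomial in
/-- Injectivity solves all the equations `b k - n • b (k + 1) = a k`, which express the vanishing
of the group of extensions of `ℤ[1/n]` by `A`. -/
theorem IsInjective.exists_sub_nsmul_eq {A : ProLiePAbZ.{u}} (hA : IsInjective A) {n : ℕ}
    (hn : 0 < n) (a : ℕ → A.toPAb) : ∃ b : ℕ → A.toPAb, ∀ k, b k - n • b (k + 1) = a k := by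
  let D := ULift.{u} ℤ[X]
  let E := ULift.{u} (aeval (R := ℤ) (n : ℚ)⁻¹).range
  have : Countable ℤ[X] := (basisMonomials ℤ).repr.toEquiv.countable_iff.mpr inferInstance
  have : IsAddTorsionFree D := AddEquiv.ulift.injective.isAddTorsionFree
    (AddEquiv.ulift : D ≃+ ℤ[X]).toAddMonoidHom
  have : IsAddTorsionFree E :=
    (Subtype.val_injective.comp AddEquiv.ulift.injective).isAddTorsionFree
      ((aeval (R := ℤ) (n : ℚ)⁻¹).range.val.toAddMonoidHom.comp
        (AddEquiv.ulift : E ≃+ _).toAddMonoidHom)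
  let f : D →+ D :=
    { toFun := fun p => ⟨(1 - C (n : ℤ) * X) * p.down⟩
      map_zero' := by simp; rfl
      map_add' := fun p q => ULift.ext _ _ (mul_add _ _ _) }
  let g : D →+ E :=
    { toFun := fun p => ⟨(aeval (R := ℤ) (n : ℚ)⁻¹).rangeRestrict p.down⟩
      map_zero' := ULift.ext _ _ (map_zero _)
      map_add' := fun p q => ULift.ext _ _ (map_add _ _ _) }
  have h1 : (1 - C (n : ℤ) * X : ℤ[X]) ≠ 0 := fun h => by
    simpa using congrArg (fun p => coeff p 0) h
  have hf : Function.Injective f := fun p q hpq =>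
    ULift.ext _ _ (mul_left_cancel₀ h1 (congrArg ULift.down hpq))
  have hg : Function.Surjective g := fun ⟨x⟩ => by
    obtain ⟨p, rfl⟩ := AlgHom.rangeRestrict_surjective _ x
    exact ⟨⟨p⟩, rfl⟩
  have hfg : ∀ y, g y = 0 ↔ y ∈ Set.range f := fun y => by
    have h2 : g y = 0 ↔ aeval (n : ℚ)⁻¹ y.down = 0 :=
      ⟨fun h => congrArg (fun z : E => (z.down : ℚ)) h, fun h => ULift.ext _ _ (Subtype.ext h)⟩
    rw [h2, aeval_inv_eq_zero_iff hn]
    exact ⟨fun ⟨q, hq⟩ => ⟨⟨q⟩, ULift.ext _ _ hq⟩, fun ⟨q, hq⟩ => ⟨q.down, congrArg ULift.down hq⟩⟩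
  -- For `h` sending `X ^ k` to `a k`, an extension `m` along `f` satisfies `m (X ^ k - n • X ^ (k +
  -- 1)) = a k`, so `b k = m (X ^ k)` works.
  let h : D →+ A.toPAb := ((basisMonomials ℤ).constr ℤ a).toAddMonoidHom.comp
    (AddEquiv.ulift : D ≃+ ℤ[X]).toAddMonoidHom
  have hX : ∀ k, h ⟨X ^ k⟩ = a k := fun k => by
    have := (basisMonomials ℤ).constr_basis ℤ a k
    simp only [coe_basisMonomials, monomial_one_right_eq_X_pow] at this
    exact this
  obtain ⟨m, hm⟩ := (hA _ (isShortExact_discreteComplex hf hg hfg)).2.2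
    ⟨ofDiscrete D (B := A.obj) h⟩
  let m' : D →+ A.toPAb := (show DiscreteCopy D →ₜ+ A.toPAb from m.hom.hom).toAddMonoidHom
  have hm' : ∀ p : D, m' (f p) = h p := fun p =>
    congrArg (fun φ : discrete D ⟶ A => (show DiscreteCopy D →ₜ+ A.toPAb from φ.hom.hom) p) hm
  refine ⟨fun k => m' ⟨X ^ k⟩, fun k => ?_⟩
  rw [← hX k, ← hm', ← map_nsmul, ← map_sub]
  congr 1
  refine ULift.ext _ _ ?_
  change X ^ k - n • X ^ (k + 1) = (1 - C (n : ℤ) * X) * X ^ k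
  rw [nsmul_eq_mul]
  simp
  ring

end ProLiePAbZ

/-- A countable torsion-free group in which all the equations `b k - n • b (k + 1) = a k` are
solvable is `n`-divisible. -/
theorem exists_nsmul_eq_of_countable {B : Type*} [AddCommGroup B] [Countable B]
    [IsAddTorsionFree B] {n : ℕ} (hn : 0 < n)
    (h : ∀ a : ℕ → B, ∃ b : ℕ → B, ∀ k, b k - n • b (k + 1) = a k) (c : B) :
    ∃ y, n • y = c := by
  choose b hb using fun ε : Set ℕ => h (fun k => open Classical in if k ∈ ε then c else 0)
  -- Subsets of `ℕ` are uncountably many, so two of them share an initial term.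
  obtain ⟨ε, δ, hεδ, hne⟩ : ∃ ε δ, b ε 0 = b δ 0 ∧ ε ≠ δ := by
    have : ¬ Function.Injective fun ε => b ε 0 := fun hi => by
      obtain ⟨e, he⟩ := exists_injective_nat B
      exact Function.cantor_injective _ (he.comp hi)
    simpa [Function.Injective] using this
  have hex : ∃ k, ¬(k ∈ ε ↔ k ∈ δ) := by
    by_contra! hcon
    exact hne (Set.ext hcon)
  classical
  let k := Nat.find hex
  have hk : ¬(k ∈ ε ↔ k ∈ δ) := Nat.find_spec hex
  -- Before the first disagreement the right-hand sides coincide, and multiplication by `n` is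
  -- injective. At `k` itself they differ by `c`, so subtracting the two equations divides `c` by
  -- `n`.
  have heq : ∀ j ≤ k, b ε j = b δ j := by
    intro j
    induction j with
    | zero => exact fun _ => hεδ
    | succ j ih =>
      intro hj
      have hjk : j ∈ ε ↔ j ∈ δ := not_not.mp (Nat.find_min hex (Nat.lt_of_succ_le hj))
      have h1 := hb ε j
      have h2 := hb δ j
      rw [ih (by omega)] at h1
      simp only [hjk] at h1
      exact nsmul_right_injective hn.ne' (sub_right_injective (h1.trans h2.symm))
  have h1 := hb ε k
  have h2 := hb δ k
  rw [heq k le_rfl] at h1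
  by_cases hkε : k ∈ ε
  · have hkδ : k ∉ δ := fun h => hk (by simp [hkε, h])
    refine ⟨b δ (k + 1) - b ε (k + 1), ?_⟩
    simp only [hkε, hkδ, if_true, if_false] at h1 h2
    rw [smul_sub, ← h1, sub_eq_zero.mp h2]
  · have hkδ : k ∈ δ := by_contra fun h => hk (by simp [hkε, h])
    refine ⟨b ε (k + 1) - b δ (k + 1), ?_⟩
    simp only [hkε, hkδ, if_true, if_false] at h1 h2
    rw [smul_sub, ← h2, sub_eq_zero.mp h1]

/-- `A` may be uncountable, so the counting argument is run in the quotients `A ⧸ N k`, where the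
equations are solved by lifting their right-hand sides to `A`. -/
theorem ProLiePAbZ.IsInjective.isDivisibleGroup {A : ProLiePAbZ.{u}} (hA : IsInjective A) :
    IsDivisibleGroup A.toPAb := by
  obtain ⟨N, hN⟩ := exists_isOpenPureBasis A.obj.property A.property
  refine isDivisibleGroup_of_dense hN fun n hn k x => ?_
  have := countable_quotient_of_isOpen (hN.isOpen k)
  have : IsAddTorsionFree (A.toPAb ⧸ N k) :=
    { nsmul_right_injective := fun m hm => by
        refine (injective_iff_map_eq_zero (nsmulAddMonoidHom (α := A.toPAb ⧸ N k) m)).mpr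
          fun z hz => ?_
        obtain ⟨z, rfl⟩ := QuotientAddGroup.mk_surjective z
        exact (QuotientAddGroup.eq_zero_iff z).mpr
          (hN.pure k m (Nat.pos_of_ne_zero hm) z ((QuotientAddGroup.eq_zero_iff _).mp hz)) }
  obtain ⟨y, hy⟩ := exists_nsmul_eq_of_countable hn (B := A.toPAb ⧸ N k) (fun a => by
    obtain ⟨b, hb⟩ := hA.exists_sub_nsmul_eq hn fun k => (a k).out
    refine ⟨fun k => b k, fun k => ?_⟩
    rw [← QuotientAddGroup.mk_nsmul, ← QuotientAddGroup.mk_sub, hb]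
    exact QuotientAddGroup.out_eq' _) x
  obtain ⟨y, rfl⟩ := QuotientAddGroup.mk_surjective y
  refine ⟨y, ?_⟩
  rw [← QuotientAddGroup.eq_zero_iff, QuotientAddGroup.mk_sub, QuotientAddGroup.mk_nsmul, hy,
    sub_self]

theorem mainTheorem11 (A : ProLiePAbZ.{u}) :
    List.TFAE
      [ProLiePAbZ.IsInjective A,
       IsDivisibleGroup A.toPAb,
       ∃ α β : ℕ∞, Nonempty (A.toPAb ≃ₜ+
         (OrdIndex α → DiscreteCopy ℚ) × (OrdIndex β → DiscreteCopy (ℕ →₀ ℚ)))] := by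
  tfae_have 1 → 2 := fun h => h.isDivisibleGroup
  tfae_have 2 → 3 := fun h => h.exists_equiv A.obj.property A.property
  tfae_have 3 → 1 := fun ⟨α, β, ⟨e⟩⟩ => by
    let _ : Module ℚ (DiscreteCopy ℚ) := show Module ℚ ℚ from inferInstance
    let _ : Module ℚ (DiscreteCopy (ℕ →₀ ℚ)) :=
      show Module ℚ (ℕ →₀ ℚ) from inferInstance
    exact ProLiePAbZ.isInjective_of_equiv e
  tfae_finish
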